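/- Let $\mathbb{N}$ denote the set of positive integers and $\varphi$ Euler's function. Let $a\ge 2$ be an integer and let $f(n)=\gamma_d n^d+\dots+\gamma_0$ be a polynomial of degree $d\ge 1$ with integer coefficients such that $\gamma_d>0$, $\gcd(\gamma_d,\dots,\gamma_0)=1$, and $f(m)\in\mathbb{N}$ for every $m\in\mathbb{N}$. Let $C_1,C_2,C_3,C_4>0$. Then there exist positive constants $x_0,c_1,c_2$, depending only on $a$, $f$, $C_1,C_2,C_3,C_4$, such that the following holds. Let $\mathcal{A}=\{a_n\}_{n=1}^{\infty}$ be a strictly increasing sequence of positive integers, and put \[ \mathcal{A}(x)=\#\{n\in\mathbb{N}: a_n\le x\},\qquad \mathcal{A}(x,r)=\#\{n\in\mathbb{N}: a_n\le x \text{ and } a_n+r\in\mathcal{A}\}. \] Let $X$ be a real number and $\eta$ a real function with $\eta(x)>0$ for $x\ge X$, and suppose that for all $x\ge X$ \[ \mathcal{A}(x)\le C_1\frac{x}{\eta(x)},\qquad \frac{x}{\eta(x)}\le C_2\,\mathcal{A}(x),\qquad \mathcal{A}(x)\le C_3\,\mathcal{A}(x/2), \] and \[ \mathcal{A}(x,r)\le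 C_4\,\frac{r}{\varphi(r)}\,\frac{x}{\eta(x)^2}\qquad\text{for every } r\in\mathbb{N}. \] For $n\in\mathbb{N}$ put $r(n)=\#\{(k,m)\in\mathbb{N}^2: a_k+a^{f(m)}=n\}$. Then \[ \#\Big\{n\in\mathbb{N}: n\le x,\ r(n)\ge c_1\frac{(\log x)^{1/d}}{\eta(x)}\Big\}\ \ge\ c_2\,x\,\frac{(\log x)^{1/d}}{(\log x)^{1/d}+\eta(x)} \] for every real $x\ge\max(x_0,X)$. -/

import Mathlib

/-- For a sequence `A = {a_n}` of positive integers, indexed by the positive integers,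
`seqCount A x` is the number of indices `n` with `a_n ≤ x`. -/
noncomputable def seqCount (A : ℕ+ → ℕ) (x : ℝ) : ℕ :=
  Set.ncard {n : ℕ+ | (A n : ℝ) ≤ x}

/-- The number of indices `n` with `a_n ≤ x` such that `a_n + r` is again a term of the sequence. -/
noncomputable def seqShiftCount (A : ℕ+ → ℕ) (x : ℝ) (r : ℕ) : ℕ :=
  Set.ncard {n : ℕ+ | (A n : ℝ) ≤ x ∧ A n + r ∈ Set.range A}

/-- `A` is a strictly increasing sequence of positive integers, and for all `x ≥ X` one has
`A(x) ≍ x / η(x)`, `A(x / 2) ≫ A(x)` and `A(x, r) ≪ (r / φ(r)) x / η(x)²` for every positive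
integer `r`, with implied constants `C₁`, `C₂` (the two halves of `≍`), `C₃` and `C₄`. -/
structure IsSieveSequence (A : ℕ+ → ℕ) (η : ℝ → ℝ) (C₁ C₂ C₃ C₄ X : ℝ) : Prop where
  pos : ∀ n, 0 < A n
  strictMono : StrictMono A
  eta_pos : ∀ x, X ≤ x → 0 < η x
  count_le : ∀ x, X ≤ x → (seqCount A x : ℝ) ≤ C₁ * (x / η x)
  le_count : ∀ x, X ≤ x → x / η x ≤ C₂ * (seqCount A x : ℝ)
  count_le_half : ∀ x, X ≤ x → (seqCount A x : ℝ) ≤ C₃ * (seqCount A (x / 2) : ℝ)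
  shiftCount_le : ∀ x, X ≤ x → ∀ r : ℕ, 0 < r →
    (seqShiftCount A x r : ℝ) ≤ C₄ * ((r : ℝ) / (Nat.totient r : ℝ) * (x / η x ^ 2))

/-- The number of pairs `(k, m)` of positive integers with `a_k + a ^ f(m) = n`. The polynomial `f`
is meant to take positive values at positive integers, so that `Int.toNat` does not change `f(m)`. -/
noncomputable def powReprCount (A : ℕ+ → ℕ) (a : ℕ) (f : Polynomial ℤ) (n : ℕ) : ℕ :=
  Set.ncard {q : ℕ+ × ℕ+ | A q.1 + a ^ (f.eval ((q.2 : ℕ) : ℤ)).toNat = n}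

/-!
The proof is Romanoff's second moment method. Put `L = (log x) ^ (1 / d)` and count only the
representations `n = a_k + a ^ f(m)` with `a_k ≤ x / 2` and `m ≤ M`, where `M ≍ L` is chosen such that
`a ^ f(m) ≤ x / 2` (`exists_pow_polyNat_le`). There are `≫ x L / η(x)` of them, all with `n ≤ x`, and
the integers with fewer than `c₁ L / η(x)` representations account for at most half. By
Cauchy–Schwarz (`sq_half_card_le_card_mul_energy`) it is enough to show that the number of
coincidences `a_k₁ + a ^ f(m₁) = a_k₂ + a ^ f(m₂)` is `≪ (x / η(x)) L (1 + L / η(x))`.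

Coincidences with `f(m₁) = f(m₂)` have `k₁ = k₂` and number `≪ (x / η(x)) L`. The others are counted
by the shift counts at `r = a ^ f(m₂) - a ^ f(m₁)` (`energy_le`), and the sieve hypothesis reduces the
claim to `∑ r / φ(r) ≪ M ^ 2` over the pairs `m₁, m₂ ≤ M` with `f(m₁) < f(m₂)`
(`exists_sum_pow_sub_pow_div_totient_le`). Up to a factor depending on `a`, `r / φ(r)` is at most the
sum of `1 / φ(e)` over squarefree `e ∣ a ^ h - 1`, with `h = f(m₂) - f(m₁)`, and `e ∣ a ^ h - 1` says that the
order of `a` modulo `e` divides `h`. Two facts finish the proof.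

* Those pairs with `ℓ ∣ f(m₂) - f(m₁)` number `≪ M ^ 2 ℓ ^ (-δ)` with `δ = 1 / d ^ 2`
  (`exists_card_pairs_le`): a residue class modulo `ℓ` is taken at most `d` times by `f` on an interval
  much shorter than `ℓ ^ δ`, because `d + 1` values divisible by `ℓ` at nearby points would make `ℓ`
  divide a small multiple of the leading coefficient.
* Romanoff's series `∑ 1 / (φ(e) ord_e(a) ^ δ)` converges
  (`exists_sum_primeWeight_mul_order_rpow_le`): all `e` with `ord_e(a) ≤ y` divide
  `D = ∏ k ≤ y, (a ^ k - 1)`, and `D / φ(D)` is smaller than any power of `y` by a weak form of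
  Mertens' theorem (`exists_prod_primes_le`).

Squarefree integers `e` are represented throughout by their sets `t` of prime factors.
-/

/-! ### The factor `n / φ(n)` -/

theorem primeQuot_eq (n : ℕ) (hn : n ≠ 0) :
    (n : ℝ) / (Nat.totient n : ℝ) = ∏ p ∈ n.primeFactors, (1 + ((p : ℝ) - 1)⁻¹) := by
  have h : (Nat.totient n : ℝ) = n * ∏ p ∈ n.primeFactors, (1 - (p : ℝ)⁻¹) := by
    have := Nat.totient_eq_mul_prod_factors n
    have h2 := congrArg (fun q : ℚ => (q : ℝ)) this
    push_cast at h2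
    exact h2
  have hn' : (n : ℝ) ≠ 0 := by exact_mod_cast hn
  rw [h, div_mul_eq_div_div, div_self hn', one_div, ← Finset.prod_inv_distrib]
  refine Finset.prod_congr rfl fun p hp => ?_
  have hp2 : (2 : ℝ) ≤ p := by exact_mod_cast (Nat.prime_of_mem_primeFactors hp).two_le
  have h1 : (p : ℝ) - 1 ≠ 0 := by linarith
  have h0 : (p : ℝ) ≠ 0 := by linarith
  field_simp
  ring

/-- The multiplicative weight `∏ 1 / (p - 1)` of a finite set of primes. -/
noncomputable def primeWeight (t : Finset ℕ) : ℝ := ∏ p ∈ t, ((p : ℝ) - 1)⁻¹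

theorem primeWeight_nonneg {t : Finset ℕ} (ht : ∀ p ∈ t, p.Prime) : 0 ≤ primeWeight t := by
  refine Finset.prod_nonneg fun p hp => ?_
  have hp2 : (2 : ℝ) ≤ p := by exact_mod_cast (ht p hp).two_le
  exact inv_nonneg.2 (by linarith)

/-- Together with `primeQuot_eq`: `n / φ(n)` is the sum of `primeWeight t` over the sets `t` of prime
divisors of `n`, that is, the sum of `1 / φ(e)` over the squarefree divisors `e` of `n`. -/
theorem prod_eq_sum_primeWeight (s : Finset ℕ) :
    ∏ p ∈ s, (1 + ((p : ℝ) - 1)⁻¹) = ∑ t ∈ s.powerset, primeWeight t := by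
  rw [Finset.prod_one_add]; rfl

/-- The upper bound of Mertens' first theorem with a crude constant, obtained by cutting into
dyadic ranges and applying Chebyshev's bound `θ(x) ≤ x log 4` on each. -/
theorem sum_log_div_le (J : ℕ) :
    ∑ p ∈ (Finset.range (2 ^ J + 1)).filter Nat.Prime, Real.log p / p ≤ 2 * Real.log 4 * J := by
  induction J with
  | zero =>
    have : (Finset.range (2 ^ 0 + 1)).filter Nat.Prime = ∅ := by decide
    rw [this]; simp
  | succ J ih =>
    have hsplit : (Finset.range (2 ^ (J + 1) + 1)).filter Nat.Prime =
        (Finset.range (2 ^ J + 1)).filter Nat.Prime ∪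
          (Finset.Ioc (2 ^ J) (2 ^ (J + 1))).filter Nat.Prime := by
      ext p
      simp only [Finset.mem_filter, Finset.mem_range, Finset.mem_union, Finset.mem_Ioc, pow_succ]
      constructor
      · rintro ⟨h, hp⟩
        by_cases h' : p < 2 ^ J + 1
        · exact Or.inl ⟨h', hp⟩
        · exact Or.inr ⟨⟨by omega, by omega⟩, hp⟩
      · rintro (⟨h, hp⟩ | ⟨h, hp⟩)
        · exact ⟨by omega, hp⟩
        · exact ⟨by omega, hp⟩
    have hdis : Disjoint ((Finset.range (2 ^ J + 1)).filter Nat.Prime)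
        ((Finset.Ioc (2 ^ J) (2 ^ (J + 1))).filter Nat.Prime) := by
      rw [Finset.disjoint_left]
      intro p hp hp'
      simp only [Finset.mem_filter, Finset.mem_range, Finset.mem_Ioc] at hp hp'
      omega
    rw [hsplit, Finset.sum_union hdis]
    have h2 : ∑ p ∈ (Finset.Ioc (2 ^ J) (2 ^ (J + 1))).filter Nat.Prime, Real.log p / p ≤
        2 * Real.log 4 := by
      have hpos : (0 : ℝ) < 2 ^ J := by positivity
      calc ∑ p ∈ (Finset.Ioc (2 ^ J) (2 ^ (J + 1))).filter Nat.Prime, Real.log p / p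
          ≤ ∑ p ∈ (Finset.Ioc (2 ^ J) (2 ^ (J + 1))).filter Nat.Prime, Real.log p / 2 ^ J := by
            refine Finset.sum_le_sum fun p hp => ?_
            simp only [Finset.mem_filter, Finset.mem_Ioc] at hp
            have : (2 : ℝ) ^ J ≤ p := by exact_mod_cast hp.1.1.le
            exact div_le_div_of_nonneg_left (Real.log_natCast_nonneg p) hpos this
        _ = (∑ p ∈ (Finset.Ioc (2 ^ J) (2 ^ (J + 1))).filter Nat.Prime, Real.log p) / 2 ^ J := by
            rw [Finset.sum_div]
        _ ≤ Chebyshev.theta ((2 ^ (J + 1) : ℕ) : ℝ) / 2 ^ J := by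
            gcongr
            rw [Chebyshev.theta_eq_sum_Icc, Nat.floor_natCast]
            refine Finset.sum_le_sum_of_subset_of_nonneg ?_ fun p _ _ => Real.log_natCast_nonneg p
            intro p hp
            simp only [Finset.mem_filter, Finset.mem_Ioc, Finset.mem_Icc] at hp ⊢
            exact ⟨⟨by omega, hp.1.2⟩, hp.2⟩
        _ ≤ (Real.log 4 * ((2 ^ (J + 1) : ℕ) : ℝ)) / 2 ^ J := by
            gcongr
            exact Chebyshev.theta_le_log4_mul_x (by positivity)
        _ = 2 * Real.log 4 := by
            push_cast; rw [pow_succ]; field_simp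
    push_cast
    linarith

/-- For `n` with at most `k` prime factors, `n / φ(n)` is at most a constant times `k ^ ε`. -/
theorem exists_prod_primes_le (ε : ℝ) (hε : 0 < ε) :
    ∃ C : ℝ, 0 < C ∧ ∀ s : Finset ℕ, (∀ p ∈ s, p.Prime) → ∀ k : ℕ, 1 ≤ k → s.card ≤ k →
      ∏ p ∈ s, (1 + ((p : ℝ) - 1)⁻¹) ≤ C * (k : ℝ) ^ ε := by
  obtain ⟨N, hN⟩ := exists_nat_ge (Real.exp (8 / ε))
  refine ⟨Real.exp (2 + 2 * N + ε), Real.exp_pos _, fun s hs k hk hcard => ?_⟩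
  have hk0 : (0 : ℝ) < k := by exact_mod_cast hk
  have hlogk : 0 ≤ Real.log k := Real.log_natCast_nonneg k
  set J := Nat.clog 2 k with hJ
  have hkJ : k ≤ 2 ^ J := Nat.le_pow_clog (by norm_num) k
  have hl2 : 0 < Real.log 2 := Real.log_pos (by norm_num)
  have hl4 : Real.log 4 = 2 * Real.log 2 := by
    rw [show (4 : ℝ) = 2 ^ 2 by norm_num, Real.log_pow]; norm_num
  have hJle : (J : ℝ) * Real.log 2 ≤ Real.log k + Real.log 2 := by
    rcases Nat.eq_zero_or_pos J with h0 | h0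
    · rw [h0]; simp; linarith
    · have h1 : 2 ^ (J - 1) < k := by
        have := Nat.pow_pred_clog_lt_self (b := 2) (by norm_num) (x := k) (by
          by_contra h
          have : k = 1 := by omega
          subst this
          simp [hJ] at h0)
        simpa [hJ] using this
      have h2 : Real.log ((2 : ℝ) ^ (J - 1)) ≤ Real.log k :=
        Real.log_le_log (by positivity) (by exact_mod_cast h1.le)
      rw [Real.log_pow, Nat.cast_sub h0] at h2
      push_cast at h2
      linarith
  -- Primes beyond `2 ^ J ≥ k` contribute at most `1 / k` each. For the primes from `N` to `2 ^ J`,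
  -- `1 / p ≤ (ε / 8) log p / p` because `N ≥ exp (8 / ε)`.
  have hterm : ∀ p ∈ s, ((p : ℝ) - 1)⁻¹ ≤
      2 * ((k : ℝ)⁻¹ + ((if p < N then 1 else 0) +
        (if p < 2 ^ J + 1 then ε / 8 * (Real.log p / p) else 0))) := by
    intro p hp
    have hp2 : (2 : ℝ) ≤ p := by exact_mod_cast (hs p hp).two_le
    have h1 : ((p : ℝ) - 1)⁻¹ ≤ 2 * (p : ℝ)⁻¹ := by
      rw [← div_eq_mul_inv, inv_le_comm₀ (by linarith) (by positivity), inv_div]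
      linarith
    refine h1.trans (mul_le_mul_of_nonneg_left ?_ (by norm_num))
    have hk' : 0 ≤ (k : ℝ)⁻¹ := by positivity
    have hpinv : (p : ℝ)⁻¹ ≤ 1 := inv_le_one_of_one_le₀ (by linarith)
    have hlp : 0 ≤ ε / 8 * (Real.log p / p) := by
      have := Real.log_natCast_nonneg p
      positivity
    by_cases hpN : p < N
    · rw [if_pos hpN]
      split_ifs <;> linarith
    · by_cases hpJ : p < 2 ^ J + 1
      · rw [if_neg hpN, if_pos hpJ]
        have : Real.exp (8 / ε) ≤ p := hN.trans (by exact_mod_cast not_lt.1 hpN)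
        have h3 : 8 / ε ≤ Real.log p := (Real.le_log_iff_exp_le (by linarith)).2 this
        have h4 : 1 ≤ ε / 8 * Real.log p := by
          have := mul_le_mul_of_nonneg_left h3 (by positivity : 0 ≤ ε / 8)
          have h5 : ε / 8 * (8 / ε) = 1 := by field_simp
          linarith
        have h6 : (p : ℝ)⁻¹ ≤ ε / 8 * (Real.log p / p) := by
          rw [← mul_div_assoc, inv_eq_one_div]
          gcongr
        linarith
      · rw [if_neg hpN, if_neg hpJ]
        have : (k : ℝ) ≤ p := by exact_mod_cast (by omega : k ≤ p)
        have : (p : ℝ)⁻¹ ≤ (k : ℝ)⁻¹ := by gcongr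
        linarith
  have hsum : ∑ p ∈ s, ((p : ℝ) - 1)⁻¹ ≤ (2 + 2 * N + ε) + ε * Real.log k := by
    have hA : ∑ p ∈ s, (k : ℝ)⁻¹ ≤ 1 := by
      rw [Finset.sum_const, nsmul_eq_mul, ← div_eq_mul_inv, div_le_one hk0]
      exact_mod_cast hcard
    have hB : ∑ p ∈ s, (if p < N then (1 : ℝ) else 0) ≤ N := by
      rw [← Finset.sum_filter, Finset.sum_const, nsmul_eq_mul, mul_one]
      have : (s.filter (· < N)).card ≤ (Finset.range N).card :=
        Finset.card_le_card fun p hp => by simpa using (Finset.mem_filter.1 hp).2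
      rw [Finset.card_range] at this
      exact_mod_cast this
    have hC : ∑ p ∈ s, (if p < 2 ^ J + 1 then ε / 8 * (Real.log p / p) else 0) ≤
        ε / 8 * (2 * Real.log 4 * J) := by
      rw [← Finset.sum_filter, ← Finset.mul_sum]
      refine mul_le_mul_of_nonneg_left ((Finset.sum_le_sum_of_subset_of_nonneg ?_ ?_).trans
        (sum_log_div_le J)) (by positivity)
      · intro p hp
        simp only [Finset.mem_filter, Finset.mem_range] at hp ⊢
        exact ⟨hp.2, hs p hp.1⟩
      · intro p _ _
        have := Real.log_natCast_nonneg p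
        positivity
    have hl2' : Real.log 2 ≤ 1 := by
      have := Real.log_two_lt_d9; linarith
    calc _ ≤ _ := Finset.sum_le_sum hterm
      _ = 2 * (∑ p ∈ s, (k : ℝ)⁻¹ + (∑ p ∈ s, (if p < N then (1 : ℝ) else 0) +
          ∑ p ∈ s, (if p < 2 ^ J + 1 then ε / 8 * (Real.log p / p) else 0))) := by
          rw [← Finset.mul_sum, Finset.sum_add_distrib, Finset.sum_add_distrib]
      _ ≤ 2 * (1 + (N + ε / 8 * (2 * Real.log 4 * J))) := by gcongr
      _ = 2 + 2 * N + ε * (J * Real.log 2) := by rw [hl4]; ring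
      _ ≤ 2 + 2 * N + ε * (Real.log k + Real.log 2) := by gcongr
      _ ≤ _ := by nlinarith
  calc ∏ p ∈ s, (1 + ((p : ℝ) - 1)⁻¹) ≤ Real.exp (∑ p ∈ s, ((p : ℝ) - 1)⁻¹) := by
        rw [Real.exp_sum]
        refine Finset.prod_le_prod (fun p hp => ?_) fun p hp => ?_
        · have hp2 : (2 : ℝ) ≤ p := by exact_mod_cast (hs p hp).two_le
          have : 0 ≤ ((p : ℝ) - 1)⁻¹ := inv_nonneg.2 (by linarith)
          linarith
        · rw [add_comm]; exact Real.add_one_le_exp _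
    _ ≤ Real.exp ((2 + 2 * N + ε) + ε * Real.log k) := Real.exp_le_exp.2 hsum
    _ = _ := by rw [Real.exp_add, Real.rpow_def_of_pos hk0, mul_comm ε]

/-- The multiplicative order of `a` modulo the product of the primes in `t`; it is `0` when `a` is
not invertible. -/
noncomputable def primeOrder (a : ℕ) (t : Finset ℕ) : ℕ :=
  orderOf ((a : ZMod (∏ p ∈ t, p)))

theorem primeOrder_dvd_iff {a : ℕ} (ha : 1 ≤ a) (t : Finset ℕ) (h : ℕ) :
    primeOrder a t ∣ h ↔ ∏ p ∈ t, p ∣ a ^ h - 1 := by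
  have h1 : 1 ≤ a ^ h := Nat.one_le_pow _ _ ha
  rw [primeOrder, orderOf_dvd_iff_pow_eq_one, ← ZMod.natCast_eq_zero_iff, Nat.cast_sub h1]
  push_cast
  rw [sub_eq_zero]

theorem card_primeFactors_prod_le {a : ℕ} (ha : 2 ≤ a) (y : ℕ) :
    (∏ k ∈ Finset.Icc 1 y, (a ^ k - 1)).primeFactors.card ≤ a * y ^ 2 := by
  set D := ∏ k ∈ Finset.Icc 1 y, (a ^ k - 1) with hD
  have hD0 : 0 < D := Finset.prod_pos fun k hk => by
    have : 1 < a ^ k := Nat.one_lt_pow (by have := (Finset.mem_Icc.1 hk).1; omega) ha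
    omega
  have h1 : 2 ^ D.primeFactors.card ≤ D := calc
    2 ^ D.primeFactors.card ≤ ∏ p ∈ D.primeFactors, p :=
        Finset.pow_card_le_prod _ _ _ fun p hp => (Nat.prime_of_mem_primeFactors hp).two_le
    _ ≤ D := Nat.le_of_dvd hD0 (Nat.prod_primeFactors_dvd D)
  have h2 : D ≤ 2 ^ (a * y ^ 2) := calc
    D ≤ ∏ k ∈ Finset.Icc 1 y, a ^ y := Finset.prod_le_prod' fun k hk =>
        (Nat.sub_le _ _).trans (Nat.pow_le_pow_right (by omega) (Finset.mem_Icc.1 hk).2)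
    _ = a ^ (y ^ 2) := by
        rw [Finset.prod_const, Nat.card_Icc, Nat.add_sub_cancel, ← pow_mul, sq]
    _ ≤ (2 ^ a) ^ (y ^ 2) := Nat.pow_le_pow_left Nat.lt_two_pow_self.le _
    _ = _ := by rw [← pow_mul]
  exact (Nat.pow_le_pow_iff_right (by norm_num)).1 (h1.trans h2)

/-- The sets of primes modulo which `a` has order at most `y` consist of prime factors of
`D = ∏ k ≤ y, (a ^ k - 1)`, so that their total weight is at most `D / φ(D)`. As `D` has
`O(y ^ 2)` prime factors, this is smaller than any power of `y`. -/
theorem exists_sum_primeWeight_order_le {a : ℕ} (ha : 2 ≤ a) (ε : ℝ) (hε : 0 < ε) :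
    ∃ C : ℝ, 0 < C ∧ ∀ (T : Finset (Finset ℕ)) (y : ℕ), 1 ≤ y → (∀ t ∈ T, ∀ p ∈ t, p.Prime) →
      (∀ t ∈ T, 1 ≤ primeOrder a t ∧ primeOrder a t ≤ y) →
      ∑ t ∈ T, primeWeight t ≤ C * (y : ℝ) ^ ε := by
  obtain ⟨C, hC, h⟩ := exists_prod_primes_le (ε / 2) (by positivity)
  refine ⟨C * (a : ℝ) ^ (ε / 2), by positivity, fun T y hy hT hTy => ?_⟩
  set D := ∏ k ∈ Finset.Icc 1 y, (a ^ k - 1) with hD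
  have hD0 : 0 < D := Finset.prod_pos fun k hk => by
    have : 1 < a ^ k := Nat.one_lt_pow (by have := (Finset.mem_Icc.1 hk).1; omega) ha
    omega
  have hsub : T ⊆ D.primeFactors.powerset := by
    intro t ht
    rw [Finset.mem_powerset]
    intro p hp
    rw [Nat.mem_primeFactors]
    refine ⟨hT t ht p hp, ?_, hD0.ne'⟩
    exact (Finset.dvd_prod_of_mem _ hp).trans
      (((primeOrder_dvd_iff (by omega) t _).1 dvd_rfl).trans
        (Finset.dvd_prod_of_mem (fun k => a ^ k - 1) (Finset.mem_Icc.2 (hTy t ht))))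
  calc ∑ t ∈ T, primeWeight t ≤ ∑ t ∈ D.primeFactors.powerset, primeWeight t :=
        Finset.sum_le_sum_of_subset_of_nonneg hsub fun t ht _ => primeWeight_nonneg fun p hp =>
          Nat.prime_of_mem_primeFactors (Finset.mem_powerset.1 ht hp)
    _ = ∏ p ∈ D.primeFactors, (1 + ((p : ℝ) - 1)⁻¹) := (prod_eq_sum_primeWeight _).symm
    _ ≤ C * ((a * y ^ 2 : ℕ) : ℝ) ^ (ε / 2) :=
        h _ (fun p hp => Nat.prime_of_mem_primeFactors hp) _
          (Nat.mul_pos (by omega) (pow_pos hy 2)) (card_primeFactors_prod_le ha y)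
    _ = C * (a : ℝ) ^ (ε / 2) * (y : ℝ) ^ ε := by
        push_cast
        rw [Real.mul_rpow (by positivity) (by positivity), ← Real.rpow_natCast, ← Real.rpow_mul
          (by positivity), ← mul_assoc]
        congr 2
        push_cast; ring

/-- Romanoff's series `∑ 1 / (φ(e) ord_e(a) ^ δ)` over squarefree `e` coprime to `a` converges for
every `δ > 0`. The partial sums over `ord_e(a) ≤ 2 ^ j` are `O(2 ^ (j δ / 2))`, which leaves a
geometric series. -/
theorem exists_sum_primeWeight_mul_order_rpow_le {a : ℕ} (ha : 2 ≤ a) (δ : ℝ) (hδ : 0 < δ) :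
    ∃ C : ℝ, 0 < C ∧ ∀ T : Finset (Finset ℕ), (∀ t ∈ T, ∀ p ∈ t, p.Prime) →
      (∀ t ∈ T, 1 ≤ primeOrder a t) →
      ∑ t ∈ T, primeWeight t * (primeOrder a t : ℝ) ^ (-δ) ≤ C := by
  obtain ⟨C, hC, h⟩ := exists_sum_primeWeight_order_le ha (δ / 2) (by positivity)
  set q : ℝ := 2 ^ (-(δ / 2)) with hq
  have hq0 : 0 < q := by positivity
  have hq1 : q < 1 := Real.rpow_lt_one_of_one_lt_of_neg (by norm_num) (by linarith)
  refine ⟨2 ^ δ * C * (1 - q)⁻¹, by have : 0 < 1 - q := by linarith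
                                    positivity, fun T hT hT1 => ?_⟩
  set J := T.sup (fun t => Nat.clog 2 (primeOrder a t)) with hJ
  have hterm : ∀ t ∈ T, primeWeight t * (primeOrder a t : ℝ) ^ (-δ) ≤
      ∑ j ∈ Finset.range (J + 1), if primeOrder a t ≤ 2 ^ j then
        2 ^ δ * ((2 ^ j : ℕ) : ℝ) ^ (-δ) * primeWeight t else 0 := by
    intro t ht
    have hw := primeWeight_nonneg (hT t ht)
    set j := Nat.clog 2 (primeOrder a t) with hj
    have hjJ : j ∈ Finset.range (J + 1) := by
      have : j ≤ J := Finset.le_sup (f := fun t => Nat.clog 2 (primeOrder a t)) ht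
      simp; omega
    have hle : primeOrder a t ≤ 2 ^ j := Nat.le_pow_clog (by norm_num) _
    have hle2 : 2 ^ j ≤ 2 * primeOrder a t := by
      rcases Nat.eq_zero_or_pos j with h0 | h0
      · rw [h0]; have := hT1 t ht; omega
      · have h1 := Nat.pow_pred_clog_lt_self (b := 2) (by norm_num) (x := primeOrder a t) (by
          by_contra hh
          have hh : primeOrder a t = 1 := by have := hT1 t ht; omega
          rw [hj, hh] at h0
          simp at h0)
        rw [← hj] at h1
        obtain ⟨i, hi⟩ : ∃ i, j = i + 1 := ⟨j - 1, by omega⟩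
        rw [hi] at h1 ⊢
        simp at h1
        rw [pow_succ]; omega
    have ho : (0 : ℝ) < primeOrder a t := by exact_mod_cast hT1 t ht
    have hkey : (primeOrder a t : ℝ) ^ (-δ) ≤ 2 ^ δ * ((2 ^ j : ℕ) : ℝ) ^ (-δ) := by
      have h1 : (((2 ^ j : ℕ) : ℝ) / 2) ≤ primeOrder a t := by
        rw [div_le_iff₀ (by norm_num), mul_comm]; exact_mod_cast hle2
      have h2 := Real.rpow_le_rpow_of_nonpos (by positivity) h1 (by linarith : -δ ≤ 0)
      rw [Real.div_rpow (by positivity) (by norm_num), Real.rpow_neg (by norm_num : (0:ℝ) ≤ 2),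
        div_inv_eq_mul, mul_comm] at h2
      exact h2
    calc primeWeight t * (primeOrder a t : ℝ) ^ (-δ)
        ≤ 2 ^ δ * ((2 ^ j : ℕ) : ℝ) ^ (-δ) * primeWeight t := by
          rw [mul_comm]; exact mul_le_mul_of_nonneg_right hkey hw
      _ = if primeOrder a t ≤ 2 ^ j then 2 ^ δ * ((2 ^ j : ℕ) : ℝ) ^ (-δ) * primeWeight t
            else 0 := by rw [if_pos hle]
      _ ≤ _ := Finset.single_le_sum (f := fun j => if primeOrder a t ≤ 2 ^ j then
            2 ^ δ * ((2 ^ j : ℕ) : ℝ) ^ (-δ) * primeWeight t else 0) (fun i _ => by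
              split_ifs
              · positivity
              · exact le_rfl) hjJ
  calc _ ≤ _ := Finset.sum_le_sum hterm
    _ = ∑ j ∈ Finset.range (J + 1), 2 ^ δ * ((2 ^ j : ℕ) : ℝ) ^ (-δ) *
          ∑ t ∈ T.filter (fun t => primeOrder a t ≤ 2 ^ j), primeWeight t := by
        rw [Finset.sum_comm]
        refine Finset.sum_congr rfl fun j _ => ?_
        rw [← Finset.sum_filter, Finset.mul_sum]
    _ ≤ ∑ j ∈ Finset.range (J + 1), 2 ^ δ * ((2 ^ j : ℕ) : ℝ) ^ (-δ) *
          (C * ((2 ^ j : ℕ) : ℝ) ^ (δ / 2)) := by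
        refine Finset.sum_le_sum fun j _ => mul_le_mul_of_nonneg_left ?_ (by positivity)
        refine h _ _ Nat.one_le_two_pow (fun t ht => hT t (Finset.mem_filter.1 ht).1)
          fun t ht => ⟨hT1 t (Finset.mem_filter.1 ht).1, (Finset.mem_filter.1 ht).2⟩
    _ = ∑ j ∈ Finset.range (J + 1), 2 ^ δ * C * q ^ j := by
        refine Finset.sum_congr rfl fun j _ => ?_
        have h2 : ((2 ^ j : ℕ) : ℝ) ^ (-δ) * ((2 ^ j : ℕ) : ℝ) ^ (δ / 2) = q ^ j := by
          rw [← Real.rpow_add (by positivity), hq, ← Real.rpow_natCast, ← Real.rpow_mul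
            (by norm_num), Nat.cast_pow, ← Real.rpow_natCast, ← Real.rpow_mul (by norm_num)]
          congr 1
          ring
        rw [← h2]; ring
    _ = 2 ^ δ * C * ∑ j ∈ Finset.range (J + 1), q ^ j := by rw [Finset.mul_sum]
    _ ≤ _ := by
        gcongr
        rw [← tsum_geometric_of_lt_one hq0.le hq1]
        exact (summable_geometric_of_lt_one hq0.le hq1).sum_le_tsum _ fun i _ => by positivity

/-! ### Congruences between polynomial values -/

open Polynomial in
/-- If `ℓ` divides `f` at `deg f + 1` integers lying within distance `H` of each other, then `ℓ`
divides a positive multiple, bounded in terms of `H`, of the leading coefficient. In the induction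
one divides `f - f(m₀)` by `X - m₀` and multiplies `N` by the differences `m - m₀`. -/
theorem exists_dvd_mul_leadingCoeff (ℓ H : ℕ) (hH : 1 ≤ H) :
    ∀ (d : ℕ) (f : ℤ[X]) (s : Finset ℤ) (N : ℕ), f.natDegree = d → s.card = d + 1 → 0 < N →
      (∀ m ∈ s, (ℓ : ℤ) ∣ N * f.eval m) → (∀ m ∈ s, ∀ m' ∈ s, (m - m').natAbs ≤ H) →
      ∃ N' : ℕ, 0 < N' ∧ N' ≤ N * H ^ (d ^ 2) ∧ (ℓ : ℤ) ∣ N' * f.leadingCoeff := by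
  intro d
  induction d with
  | zero =>
    intro f s N hf hs hN hdvd _
    obtain ⟨m, hm⟩ := Finset.card_pos.1 (by omega : 0 < s.card)
    refine ⟨N, hN, by simp, ?_⟩
    have := hdvd m hm
    rw [eq_C_of_natDegree_eq_zero hf, eval_C] at this
    rwa [leadingCoeff, hf]
  | succ d ih =>
    intro f s N hf hs hN hdvd hH'
    obtain ⟨m₀, hm₀⟩ := Finset.card_pos.1 (by omega : 0 < s.card)
    set g := f /ₘ (X - C m₀) with hg
    have hdeg : f.degree ≠ 0 := by
      rw [degree_eq_natDegree (by rintro rfl; simp at hf), hf]; norm_cast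
    have hlead : g.leadingCoeff = f.leadingCoeff := leadingCoeff_divByMonic_X_sub_C f hdeg m₀
    have hgd : g.natDegree = d := by
      rw [hg, natDegree_divByMonic f (monic_X_sub_C m₀), natDegree_X_sub_C, hf]; omega
    have heval : ∀ m, f.eval m - f.eval m₀ = (m - m₀) * g.eval m := by
      intro m
      have h := modByMonic_add_div f (X - C m₀)
      rw [modByMonic_X_sub_C_eq_C_eval] at h
      have h2 := congrArg (eval m) h
      simp only [eval_add, eval_mul, eval_sub, eval_X, eval_C] at h2
      rw [← h2, hg]; ring
    set P := ∏ m ∈ s.erase m₀, (m - m₀).natAbs with hP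
    have hP0 : 0 < P := Finset.prod_pos fun m hm => by
      have := (Finset.mem_erase.1 hm).1
      omega
    have hcard : (s.erase m₀).card = d + 1 := by rw [Finset.card_erase_of_mem hm₀, hs]; omega
    have hPH : P ≤ H ^ (d + 1) := by
      rw [← hcard]
      exact Finset.prod_le_pow_card _ _ _ fun m hm => hH' m (Finset.mem_of_mem_erase hm) m₀ hm₀
    obtain ⟨N', h1, h2, h3⟩ := ih g (s.erase m₀) (N * P) hgd hcard (Nat.mul_pos hN hP0) (by
      intro m hm
      have hd : (m - m₀) ∣ (P : ℤ) := by
        rw [← Int.natAbs_dvd]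
        exact_mod_cast Finset.dvd_prod_of_mem (fun m : ℤ => (m - m₀).natAbs) hm
      have h4 : (ℓ : ℤ) ∣ N * ((m - m₀) * g.eval m) := by
        rw [← heval, mul_sub]
        exact dvd_sub (hdvd m (Finset.mem_of_mem_erase hm)) (hdvd m₀ hm₀)
      refine h4.trans ?_
      push_cast
      rw [mul_assoc]
      exact mul_dvd_mul_left _ (mul_dvd_mul_right hd _))
      fun m hm m' hm' => hH' m (Finset.mem_of_mem_erase hm) m' (Finset.mem_of_mem_erase hm')
    refine ⟨N', h1, h2.trans ?_, hlead ▸ h3⟩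
    calc N * P * H ^ (d ^ 2) ≤ N * H ^ (d + 1) * H ^ (d ^ 2) := by gcongr
      _ = N * H ^ (d + 1 + d ^ 2) := by rw [mul_assoc, ← pow_add]
      _ ≤ N * H ^ ((d + 1) ^ 2) := by
        gcongr
        nlinarith

/-- When `ℓ` exceeds `γ H ^ (d ^ 2)`, an interval of length `H` contains at most `d` solutions of
`f(m) ≡ c` modulo `ℓ`. -/
theorem card_congruence_le (f : Polynomial ℤ) (hdeg : 1 ≤ f.natDegree) (γ ℓ H : ℕ) (hγ : 0 < γ)
    (hlead : f.leadingCoeff = γ) (hH : 1 ≤ H) (hℓ : γ * H ^ (f.natDegree ^ 2) < ℓ) (c : ℤ) (M : ℕ) :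
    ((Finset.Icc 1 M).filter fun m : ℕ => (ℓ : ℤ) ∣ f.eval (m : ℤ) - c).card ≤
      f.natDegree * (M / H + 1) := by
  have key := Finset.card_le_mul_card_image_of_maps_to
    (s := (Finset.Icc 1 M).filter fun m : ℕ => (ℓ : ℤ) ∣ f.eval (m : ℤ) - c)
    (t := Finset.range (M / H + 1)) (f := fun m => m / H) (by
      intro m hm
      simp only [Finset.mem_filter, Finset.mem_Icc] at hm
      rw [Finset.mem_range]
      exact Nat.lt_succ_of_le (Nat.div_le_div_right hm.1.2)) f.natDegree (by
      intro b _
      by_contra hcon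
      obtain ⟨s, hs, hcard⟩ := Finset.exists_subset_card_eq (Nat.succ_le_of_lt (not_le.1 hcon))
      obtain ⟨N', h1, h2, h3⟩ := exists_dvd_mul_leadingCoeff ℓ H hH f.natDegree
        (f - Polynomial.C c) (s.map Nat.castEmbedding) 1 (Polynomial.natDegree_sub_C)
        (by simpa using hcard) one_pos (by
          intro m hm
          obtain ⟨k, hk, rfl⟩ := Finset.mem_map.1 hm
          have := hs hk
          simp only [Finset.mem_filter] at this
          simpa using this.1.2) (by
          intro m hm m' hm'
          obtain ⟨k, hk, rfl⟩ := Finset.mem_map.1 hm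
          obtain ⟨k', hk', rfl⟩ := Finset.mem_map.1 hm'
          have e1 := (Finset.mem_filter.1 (hs hk)).2
          have e2 := (Finset.mem_filter.1 (hs hk')).2
          have q1 := Nat.div_add_mod k H
          have q2 := Nat.div_add_mod k' H
          have r1 := Nat.mod_lt k hH
          have r2 := Nat.mod_lt k' hH
          rw [e1] at q1
          rw [e2] at q2
          simp only [Nat.castEmbedding_apply]
          omega)
      have hl : (f - Polynomial.C c).leadingCoeff = γ := by
        rw [Polynomial.leadingCoeff_sub_of_degree_lt, hlead]
        exact Polynomial.degree_C_le.trans_lt (Polynomial.natDegree_pos_iff_degree_pos.1 hdeg)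
      rw [hl] at h3
      have h4 : ℓ ≤ N' * γ := Nat.le_of_dvd (Nat.mul_pos h1 hγ) (by exact_mod_cast h3)
      have h5 : N' * γ ≤ γ * H ^ (f.natDegree ^ 2) := by
        rw [mul_comm]; exact Nat.mul_le_mul_left _ (by simpa using h2)
      omega)
  simpa using key

/-- The value `f(m)` of an integer polynomial as a natural number; negative values become `0`. -/
def polyNat (f : Polynomial ℤ) (m : ℕ) : ℕ := (f.eval (m : ℤ)).toNat

theorem polyNat_cast {f : Polynomial ℤ} (hpos : ∀ m : ℕ+, 0 < f.eval ((m : ℕ) : ℤ)) {m : ℕ}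
    (hm : 1 ≤ m) : (polyNat f m : ℤ) = f.eval (m : ℤ) :=
  Int.toNat_of_nonneg (hpos ⟨m, hm⟩).le

theorem exists_polyNat_le (f : Polynomial ℤ) :
    ∃ B : ℕ, 1 ≤ B ∧ ∀ m : ℕ, 1 ≤ m → polyNat f m ≤ B * m ^ f.natDegree := by
  refine ⟨∑ i ∈ Finset.range (f.natDegree + 1), (f.coeff i).natAbs + 1, by omega, fun m hm => ?_⟩
  rw [polyNat, Int.toNat_le, Polynomial.eval_eq_sum_range]
  push_cast
  have hm' : (1 : ℤ) ≤ m := by exact_mod_cast hm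
  calc ∑ i ∈ Finset.range (f.natDegree + 1), f.coeff i * (m : ℤ) ^ i
      ≤ ∑ i ∈ Finset.range (f.natDegree + 1), |f.coeff i| * (m : ℤ) ^ f.natDegree := by
        refine Finset.sum_le_sum fun i hi => ?_
        have h1 : (m : ℤ) ^ i ≤ (m : ℤ) ^ f.natDegree :=
          pow_le_pow_right₀ hm' (by simpa [Nat.lt_succ_iff] using hi)
        calc _ ≤ |f.coeff i| * (m : ℤ) ^ i :=
              mul_le_mul_of_nonneg_right (le_abs_self _) (by positivity)
          _ ≤ _ := mul_le_mul_of_nonneg_left h1 (abs_nonneg _)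
    _ = (∑ i ∈ Finset.range (f.natDegree + 1), |f.coeff i|) * (m : ℤ) ^ f.natDegree := by
        rw [Finset.sum_mul]
    _ ≤ _ := mul_le_mul_of_nonneg_right (by linarith) (by positivity)

/-- Equality is a congruence modulo every `ℓ`; with `ℓ` large and `H = M + 1`, the bound
`card_congruence_le` allows `d` values of the second coordinate for each value of the first. -/
theorem card_polyNat_eq_le {f : Polynomial ℤ} (hdeg : 1 ≤ f.natDegree)
    (hlead : 0 < f.leadingCoeff) (hpos : ∀ m : ℕ+, 0 < f.eval ((m : ℕ) : ℤ)) (M : ℕ) :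
    ((Finset.Icc 1 M ×ˢ Finset.Icc 1 M).filter fun q : ℕ × ℕ =>
      polyNat f q.1 = polyNat f q.2).card ≤ f.natDegree * M := by
  obtain ⟨γ, hγ⟩ := Int.eq_ofNat_of_zero_le hlead.le
  have hγ0 : 0 < γ := by omega
  have key := Finset.card_le_mul_card_image_of_maps_to
    (s := (Finset.Icc 1 M ×ˢ Finset.Icc 1 M).filter fun q : ℕ × ℕ =>
      polyNat f q.1 = polyNat f q.2)
    (t := Finset.Icc 1 M) (f := fun q => q.1) (by
      intro q hq
      simp only [Finset.mem_filter, Finset.mem_product] at hq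
      exact hq.1.1) f.natDegree (by
      intro b hb
      have h := card_congruence_le f hdeg γ (γ * (M + 1) ^ (f.natDegree ^ 2) + 1) (M + 1) hγ0 hγ
        (by omega) (by omega) (f.eval (b : ℤ)) M
      rw [Nat.div_eq_of_lt (by omega), zero_add, mul_one] at h
      refine le_trans (Finset.card_le_card_of_injOn (fun q => q.2) ?_ ?_) h
      · rintro ⟨m, m'⟩ hq
        simp only [Finset.coe_filter, Finset.mem_filter, Finset.mem_product, Set.mem_ofPred_eq,
          Finset.mem_Icc] at hq ⊢
        obtain ⟨⟨⟨h1, h2⟩, h3⟩, rfl⟩ := hq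
        refine ⟨h2, ?_⟩
        rw [← polyNat_cast hpos h1.1, ← polyNat_cast hpos h2.1, h3, sub_self]
        exact dvd_zero _
      · rintro ⟨m, m'⟩ hq ⟨n, n'⟩ hq' h
        simp only [Finset.coe_filter, Finset.mem_filter, Set.mem_ofPred_eq] at hq hq' h
        rw [Prod.mk.injEq, hq.2, hq'.2]
        exact ⟨rfl, h⟩)
  simpa using key

theorem rpow_inv_le_of_le_mul_pow {ℓ K Y n : ℕ} (hn : n ≠ 0) (hK : 1 ≤ K) (h : ℓ ≤ K * Y ^ n) :
    (ℓ : ℝ) ^ ((n : ℝ)⁻¹) ≤ K * Y := by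
  have h1 : (ℓ : ℝ) ≤ ((K : ℝ) * Y) ^ n := by
    have : ℓ ≤ (K * Y) ^ n := by
      rw [mul_pow]
      exact h.trans (Nat.mul_le_mul_right _ (Nat.le_self_pow hn K))
    exact_mod_cast this
  calc (ℓ : ℝ) ^ ((n : ℝ)⁻¹) ≤ (((K : ℝ) * Y) ^ n) ^ ((n : ℝ)⁻¹) :=
        Real.rpow_le_rpow (by positivity) h1 (by positivity)
    _ = _ := Real.pow_rpow_inv_natCast (by positivity) hn

/-- The pairs with `f(m₁) < f(m₂)` and `ℓ ∣ f(m₂) - f(m₁)` have density `O(ℓ ^ (-δ))` in the square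
of side `M`, with `δ = 1 / d ^ 2`. This holds uniformly in `M` and `ℓ`, since positive
values `f(m₂) - f(m₁)` divisible by `ℓ` force `ℓ = O(M ^ d)`. -/
theorem exists_card_pairs_le {f : Polynomial ℤ} (hdeg : 1 ≤ f.natDegree)
    (hlead : 0 < f.leadingCoeff) (hpos : ∀ m : ℕ+, 0 < f.eval ((m : ℕ) : ℤ)) :
    ∃ C : ℝ, 0 < C ∧ ∀ M ℓ : ℕ, 1 ≤ ℓ →
      (((Finset.Icc 1 M ×ˢ Finset.Icc 1 M).filter fun q : ℕ × ℕ =>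
        polyNat f q.1 < polyNat f q.2 ∧ ℓ ∣ polyNat f q.2 - polyNat f q.1).card : ℝ) ≤
      C * (M : ℝ) ^ 2 * (ℓ : ℝ) ^ (-((f.natDegree ^ 2 : ℕ) : ℝ)⁻¹) := by
  obtain ⟨γ, hγ⟩ := Int.eq_ofNat_of_zero_le hlead.le
  have hγ0 : 0 < γ := by omega
  obtain ⟨B, hB, hBle⟩ := exists_polyNat_le f
  set d := f.natDegree with hd
  have hd2 : d ^ 2 ≠ 0 := by positivity
  refine ⟨γ + d * (2 * γ + B), by positivity, fun M ℓ hℓ => ?_⟩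
  set Q := (Finset.Icc 1 M ×ˢ Finset.Icc 1 M).filter fun q : ℕ × ℕ =>
        polyNat f q.1 < polyNat f q.2 ∧ ℓ ∣ polyNat f q.2 - polyNat f q.1 with hQ
  have hℓ0 : (0 : ℝ) < ℓ := by exact_mod_cast hℓ
  rw [Real.rpow_neg hℓ0.le, ← div_eq_mul_inv, le_div_iff₀ (by positivity)]
  rcases Q.eq_empty_or_nonempty with h0 | ⟨q, hq⟩
  · rw [h0]; simp; positivity
  have hM : ℓ ≤ B * M ^ (d ^ 2) := by
    simp only [hQ, Finset.mem_filter, Finset.mem_product, Finset.mem_Icc] at hq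
    obtain ⟨⟨h1, h2⟩, h3, h4⟩ := hq
    calc ℓ ≤ polyNat f q.2 - polyNat f q.1 := Nat.le_of_dvd (by omega) h4
      _ ≤ B * q.2 ^ d := (Nat.sub_le _ _).trans (hBle _ h2.1)
      _ ≤ B * M ^ d := by gcongr; exact h2.2
      _ ≤ B * M ^ (d ^ 2) := by
        gcongr
        · omega
        · nlinarith
  have hMr := rpow_inv_le_of_le_mul_pow hd2 hB hM
  by_cases hsmall : ℓ ≤ γ
  · have h1 : (Q.card : ℝ) ≤ (M : ℝ) ^ 2 := by
      have : Q.card ≤ M ^ 2 := by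
        refine (Finset.card_filter_le _ _).trans ?_
        simp [sq]
      exact_mod_cast this
    have h2 := rpow_inv_le_of_le_mul_pow (ℓ := ℓ) (Y := 1) hd2 hγ0 (by simpa using hsmall)
    rw [Nat.cast_one, mul_one] at h2
    calc (Q.card : ℝ) * (ℓ : ℝ) ^ (((d ^ 2 : ℕ) : ℝ)⁻¹) ≤ (M : ℝ) ^ 2 * γ := by gcongr
      _ ≤ (γ + d * (2 * γ + B)) * (M : ℝ) ^ 2 := by
        have : 0 ≤ d * (2 * γ + B) * (M : ℝ) ^ 2 := by positivity
        linarith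
  · -- The longest intervals on which a residue class has at most `d` preimages.
    obtain ⟨H, hH1, hH2, hH3⟩ : ∃ H : ℕ, 1 ≤ H ∧ γ * H ^ (d ^ 2) < ℓ ∧
        ℓ ≤ γ * (H + 1) ^ (d ^ 2) := by
      have hex : ∃ H : ℕ, ℓ ≤ γ * (H + 1) ^ (d ^ 2) := ⟨ℓ, by
        have := Nat.le_self_pow hd2 (ℓ + 1)
        nlinarith⟩
      have hfind := Nat.find_spec hex
      have hne : Nat.find hex ≠ 0 := by
        intro h
        rw [h] at hfind
        simp at hfind
        omega
      refine ⟨Nat.find hex, by omega, ?_, hfind⟩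
      have := Nat.find_min hex (Nat.sub_lt (Nat.pos_of_ne_zero hne) one_pos)
      rwa [show Nat.find hex - 1 + 1 = Nat.find hex by omega, not_le] at this
    have hH0 : (0 : ℝ) < H := by exact_mod_cast hH1
    have hHr : (ℓ : ℝ) ^ (((d ^ 2 : ℕ) : ℝ)⁻¹) ≤ 2 * γ * H := by
      have := rpow_inv_le_of_le_mul_pow (Y := H + 1) hd2 hγ0 hH3
      refine this.trans ?_
      have h1 : (1 : ℝ) ≤ H := by exact_mod_cast hH1
      push_cast
      nlinarith [(Nat.cast_nonneg γ : (0 : ℝ) ≤ γ)]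
    have hcard : Q.card ≤ d * (M / H + 1) * M := by
      have key := Finset.card_le_mul_card_image_of_maps_to (s := Q)
        (t := Finset.Icc 1 M) (f := fun q => q.1) (by
          intro q hq
          simp only [hQ, Finset.mem_filter, Finset.mem_product] at hq
          exact hq.1.1) (d * (M / H + 1)) (by
          intro b hb
          refine le_trans (Finset.card_le_card_of_injOn (fun q => q.2) ?_ ?_)
            (card_congruence_le f hdeg γ ℓ H hγ0 hγ hH1 hH2 (f.eval (b : ℤ)) M)
          · rintro ⟨m, m'⟩ hq
            simp only [hQ, Finset.coe_filter, Finset.mem_filter, Finset.mem_product,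
              Set.mem_ofPred_eq, Finset.mem_Icc] at hq ⊢
            obtain ⟨⟨⟨h1, h2⟩, h3, h4⟩, rfl⟩ := hq
            refine ⟨h2, ?_⟩
            rw [← polyNat_cast hpos h1.1, ← polyNat_cast hpos h2.1, ← Nat.cast_sub h3.le]
            exact_mod_cast h4
          · rintro ⟨m, m'⟩ hq ⟨n, n'⟩ hq' h
            simp only [Finset.coe_filter, Set.mem_ofPred_eq] at hq hq' h
            rw [Prod.mk.injEq, hq.2, hq'.2]
            exact ⟨rfl, h⟩)
      simpa using key
    have hcard' : (Q.card : ℝ) ≤ d * (M / H + 1) * M := by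
      have h1 : ((M / H : ℕ) : ℝ) ≤ M / H := Nat.cast_div_le
      have h2 : (Q.card : ℝ) ≤ d * ((M / H : ℕ) + 1) * M := by exact_mod_cast hcard
      exact h2.trans (by gcongr)
    set R := (ℓ : ℝ) ^ (((d ^ 2 : ℕ) : ℝ)⁻¹) with hR
    have hR0 : 0 ≤ R := by positivity
    calc (Q.card : ℝ) * R ≤ d * (M / H + 1) * M * R := by gcongr
      _ = d * M * (M * (R / H) + R) := by field_simp
      _ ≤ d * M * (M * (2 * γ) + B * M) := by
        gcongr
        rw [div_le_iff₀ hH0]; exact hHr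
      _ = d * (2 * γ + B) * (M : ℝ) ^ 2 := by ring
      _ ≤ (γ + d * (2 * γ + B)) * (M : ℝ) ^ 2 := by gcongr; simp

/-- On average over pairs `m₁, m₂ ≤ M`, the factor `r / φ(r)` at `r = a ^ f(m₂) - a ^ f(m₁)` is
bounded. The primes of a set `t` all divide `a ^ h - 1` exactly if `primeOrder a t ∣ h`, so
expanding `r / φ(r)` by `prod_eq_sum_primeWeight` and counting pairs for each `t`
leaves Romanoff's series. -/
theorem exists_sum_pow_sub_pow_div_totient_le {a : ℕ} (ha : 2 ≤ a) {f : Polynomial ℤ}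
    (hdeg : 1 ≤ f.natDegree) (hlead : 0 < f.leadingCoeff)
    (hpos : ∀ m : ℕ+, 0 < f.eval ((m : ℕ) : ℤ)) :
    ∃ C : ℝ, 0 < C ∧ ∀ M : ℕ,
      ∑ q ∈ (Finset.Icc 1 M ×ˢ Finset.Icc 1 M).filter (fun q : ℕ × ℕ =>
          polyNat f q.1 < polyNat f q.2),
        ((a ^ polyNat f q.2 - a ^ polyNat f q.1 : ℕ) : ℝ) /
          (Nat.totient (a ^ polyNat f q.2 - a ^ polyNat f q.1) : ℝ) ≤ C * (M : ℝ) ^ 2 := by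
  obtain ⟨C, hC, hcard⟩ := exists_card_pairs_le hdeg hlead hpos
  set δ : ℝ := ((f.natDegree ^ 2 : ℕ) : ℝ)⁻¹ with hδ
  have hδ0 : 0 < δ := by positivity
  obtain ⟨C', hC', hsum⟩ := exists_sum_primeWeight_mul_order_rpow_le ha δ hδ0
  set G : ℝ := ∏ p ∈ a.primeFactors, (1 + ((p : ℝ) - 1)⁻¹) with hG
  have hfac : ∀ {n p : ℕ}, p ∈ n.primeFactors → 1 ≤ 1 + ((p : ℝ) - 1)⁻¹ := by
    intro n p hp
    have hp2 : (2 : ℝ) ≤ p := by exact_mod_cast (Nat.prime_of_mem_primeFactors hp).two_le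
    have : 0 ≤ ((p : ℝ) - 1)⁻¹ := inv_nonneg.2 (by linarith)
    linarith
  have hG0 : 0 < G := Finset.prod_pos fun p hp => one_pos.trans_le (hfac hp)
  refine ⟨G * (C * C'), by positivity, fun M => ?_⟩
  set P := (Finset.Icc 1 M ×ˢ Finset.Icc 1 M).filter (fun q : ℕ × ℕ =>
          polyNat f q.1 < polyNat f q.2) with hP
  set h : ℕ × ℕ → ℕ := fun q => polyNat f q.2 - polyNat f q.1 with hh
  have hpow : ∀ q ∈ P, 0 < h q ∧ 0 < a ^ h q - 1 := by
    intro q hq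
    have h1 := (Finset.mem_filter.1 hq).2
    have h2 : 0 < h q := Nat.sub_pos_of_lt h1
    have h3 : 1 < a ^ h q := Nat.one_lt_pow h2.ne' ha
    exact ⟨h2, by omega⟩
  -- All sets of primes that occur in the expansions for the pairs in `P`.
  set T := P.biUnion fun q => (a ^ h q - 1).primeFactors.powerset with hT
  have hTprime : ∀ t ∈ T, ∀ p ∈ t, p.Prime := by
    intro t ht p hp
    obtain ⟨q, hq, htq⟩ := Finset.mem_biUnion.1 ht
    exact Nat.prime_of_mem_primeFactors (Finset.mem_powerset.1 htq hp)
  have hdvd : ∀ q ∈ P, ∀ t ∈ (a ^ h q - 1).primeFactors.powerset, primeOrder a t ∣ h q := by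
    intro q hq t ht
    rw [primeOrder_dvd_iff (by omega)]
    exact (Finset.prod_dvd_prod_of_subset _ _ _ (Finset.mem_powerset.1 ht)).trans
      (Nat.prod_primeFactors_dvd _)
  have hT1 : ∀ t ∈ T, 1 ≤ primeOrder a t := by
    intro t ht
    obtain ⟨q, hq, htq⟩ := Finset.mem_biUnion.1 ht
    exact Nat.pos_of_dvd_of_pos (hdvd q hq t htq) (hpow q hq).1
  have hterm : ∀ q ∈ P, ((a ^ polyNat f q.2 - a ^ polyNat f q.1 : ℕ) : ℝ) /
      (Nat.totient (a ^ polyNat f q.2 - a ^ polyNat f q.1) : ℝ) ≤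
      G * ∑ t ∈ T, if primeOrder a t ∣ h q then primeWeight t else 0 := by
    intro q hq
    have h1 := (Finset.mem_filter.1 hq).2
    have hr : a ^ polyNat f q.2 - a ^ polyNat f q.1 = a ^ polyNat f q.1 * (a ^ h q - 1) := by
      rw [Nat.mul_sub, ← pow_add, mul_one, hh]
      congr 2
      simp only
      omega
    have ha0 : a ^ polyNat f q.1 ≠ 0 := pow_ne_zero _ (by omega)
    have hne := (hpow q hq).2.ne'
    rw [hr, primeQuot_eq _ (mul_ne_zero ha0 hne), Nat.primeFactors_mul ha0 hne]
    have hsub : (a ^ polyNat f q.1).primeFactors ⊆ a.primeFactors := by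
      intro p hp
      have hp' := Nat.prime_of_mem_primeFactors hp
      exact Nat.mem_primeFactors.2
        ⟨hp', hp'.dvd_of_dvd_pow (Nat.dvd_of_mem_primeFactors hp), by omega⟩
    calc ∏ p ∈ (a ^ polyNat f q.1).primeFactors ∪ (a ^ h q - 1).primeFactors,
          (1 + ((p : ℝ) - 1)⁻¹)
        ≤ ∏ p ∈ a.primeFactors ∪ (a ^ h q - 1).primeFactors, (1 + ((p : ℝ) - 1)⁻¹) := by
          refine Finset.prod_le_prod_of_subset_of_one_le (Finset.union_subset_union_left hsub)
            (fun p hp => ?_) fun p hp _ => ?_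
          · rcases Finset.mem_union.1 hp with hp | hp
            · exact zero_le_one.trans (hfac hp)
            · exact zero_le_one.trans (hfac hp)
          · rcases Finset.mem_union.1 hp with hp | hp
            · exact hfac hp
            · exact hfac hp
      _ ≤ G * ∏ p ∈ (a ^ h q - 1).primeFactors, (1 + ((p : ℝ) - 1)⁻¹) := by
          rw [hG, ← Finset.prod_union_inter]
          refine le_mul_of_one_le_right (Finset.prod_nonneg fun p hp => ?_)
            (Finset.one_le_prod fun p hp => ?_)
          · rcases Finset.mem_union.1 hp with hp | hp
            · exact zero_le_one.trans (hfac hp)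
            · exact zero_le_one.trans (hfac hp)
          · exact hfac (Finset.mem_inter.1 hp).1
      _ = G * ∑ t ∈ (a ^ h q - 1).primeFactors.powerset, primeWeight t := by
          rw [prod_eq_sum_primeWeight]
      _ ≤ _ := by
          gcongr
          rw [← Finset.sum_filter]
          refine Finset.sum_le_sum_of_subset_of_nonneg (fun t ht => ?_) fun t ht _ =>
            primeWeight_nonneg (hTprime t (Finset.mem_filter.1 ht).1)
          exact Finset.mem_filter.2 ⟨Finset.mem_biUnion.2 ⟨q, hq, ht⟩, hdvd q hq t ht⟩
  calc _ ≤ _ := Finset.sum_le_sum hterm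
    _ = G * ∑ t ∈ T, primeWeight t * ((P.filter fun q => primeOrder a t ∣ h q).card : ℝ) := by
        rw [← Finset.mul_sum, Finset.sum_comm]
        congr 1
        refine Finset.sum_congr rfl fun t _ => ?_
        rw [← Finset.sum_filter, Finset.sum_const, nsmul_eq_mul, mul_comm]
    _ ≤ G * ∑ t ∈ T, primeWeight t * (C * (M : ℝ) ^ 2 * (primeOrder a t : ℝ) ^ (-δ)) := by
        gcongr with t ht
        · exact primeWeight_nonneg (hTprime t ht)
        · rw [hP, Finset.filter_filter]
          exact hcard M _ (hT1 t ht)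
    _ = G * (C * (M : ℝ) ^ 2 * ∑ t ∈ T, primeWeight t * (primeOrder a t : ℝ) ^ (-δ)) := by
        congr 1
        rw [Finset.mul_sum]
        exact Finset.sum_congr rfl fun t _ => by ring
    _ ≤ G * (C * (M : ℝ) ^ 2 * C') := by
        gcongr
        exact hsum T hTprime hT1
    _ = _ := by ring

/-! ### Second moment of the number of representations -/

/-- Cauchy–Schwarz for the fibre sizes of `φ` on the set `S` where they are at least `τ`: the fibres
below `τ` account for at most half of `U`. -/
theorem sq_half_card_le_card_mul_energy {α β : Type*} [DecidableEq β] (U : Finset α)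
    (N : Finset β) (φ : α → β) (hφ : ∀ u ∈ U, φ u ∈ N) (τ : ℝ)
    (hτ : (N.card : ℝ) * τ ≤ (U.card : ℝ) / 2) (S : Finset β)
    (hS : ∀ n, n ∈ S ↔ n ∈ N ∧ τ ≤ ((U.filter fun u => φ u = n).card : ℝ)) :
    ((U.card : ℝ) / 2) ^ 2 ≤
      (S.card : ℝ) * (((U ×ˢ U).filter fun q => φ q.1 = φ q.2).card : ℝ) := by
  classical
  set r : β → ℝ := fun n => ((U.filter fun u => φ u = n).card : ℝ) with hr
  have hSN : S ⊆ N := fun n hn => ((hS n).1 hn).1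
  have h1 : ∑ n ∈ N, r n = U.card := by
    rw [Finset.card_eq_sum_card_fiberwise hφ]; push_cast; rfl
  have h2 : ∑ n ∈ N, r n ^ 2 = (((U ×ˢ U).filter fun q => φ q.1 = φ q.2).card : ℝ) := by
    rw [Finset.card_eq_sum_card_fiberwise (f := fun q => φ q.1) (t := N) (fun q hq =>
      hφ _ (Finset.mem_product.1 (Finset.mem_filter.1 hq).1).1)]
    push_cast
    refine Finset.sum_congr rfl fun n _ => ?_
    rw [hr, sq, ← Nat.cast_mul, ← Finset.card_product]
    congr 2
    ext ⟨u, v⟩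
    simp only [Finset.mem_product, Finset.mem_filter]
    constructor
    · rintro ⟨⟨hu, h⟩, hv, h'⟩
      exact ⟨⟨⟨hu, hv⟩, h.trans h'.symm⟩, h⟩
    · rintro ⟨⟨⟨hu, hv⟩, h⟩, h'⟩
      exact ⟨⟨hu, h'⟩, hv, h ▸ h'⟩
  have h3 : ∑ n ∈ N \ S, r n ≤ (U.card : ℝ) / 2 := by
    rcases (N \ S).eq_empty_or_nonempty with he | ⟨n₀, hn₀⟩
    · rw [he, Finset.sum_empty]; positivity
    · -- A fibre of size at most `τ` shows that `τ` is not negative.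
      have hlt : ∀ n ∈ N \ S, r n ≤ τ := fun n hn => by
        obtain ⟨hn1, hn2⟩ := Finset.mem_sdiff.1 hn
        by_contra hcon
        exact hn2 ((hS n).2 ⟨hn1, (not_le.1 hcon).le⟩)
      have hτ0 : 0 ≤ τ := le_trans (Nat.cast_nonneg _) (hlt n₀ hn₀)
      calc ∑ n ∈ N \ S, r n ≤ ∑ n ∈ N \ S, τ := Finset.sum_le_sum hlt
        _ = ((N \ S).card : ℝ) * τ := by rw [Finset.sum_const, nsmul_eq_mul]
        _ ≤ (N.card : ℝ) * τ := by gcongr; exact Finset.sdiff_subset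
        _ ≤ _ := hτ
  have h4 : (U.card : ℝ) / 2 ≤ ∑ n ∈ S, r n := by
    have := Finset.sum_sdiff hSN (f := r)
    linarith
  calc ((U.card : ℝ) / 2) ^ 2 ≤ (∑ n ∈ S, r n) ^ 2 := by gcongr
    _ ≤ S.card * ∑ n ∈ S, r n ^ 2 := sq_sum_le_card_mul_sum_sq
    _ ≤ S.card * ∑ n ∈ N, r n ^ 2 := by
      gcongr
    _ = _ := by rw [h2]

theorem finite_seq_le {A : ℕ+ → ℕ} (hA : StrictMono A) (x : ℝ) :
    {n : ℕ+ | (A n : ℝ) ≤ x}.Finite := by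
  refine ((Set.finite_Iic ⌊x⌋₊).preimage hA.injective.injOn).subset fun n hn => ?_
  exact Nat.le_floor hn

theorem finite_powRepr {A : ℕ+ → ℕ} (hA : StrictMono A) {a : ℕ} (ha : 2 ≤ a) {f : Polynomial ℤ}
    (hdeg : 1 ≤ f.natDegree) (hpos : ∀ m : ℕ+, 0 < f.eval ((m : ℕ) : ℤ)) (n : ℕ) :
    {q : ℕ+ × ℕ+ | A q.1 + a ^ (f.eval ((q.2 : ℕ) : ℤ)).toNat = n}.Finite := by
  have hfib : {m : ℕ+ | polyNat f m ≤ n}.Finite := by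
    have h1 : (⋃ j ∈ Set.Iic n, {z : ℤ | (f - Polynomial.C (j : ℤ)).IsRoot z}).Finite := by
      refine (Set.finite_Iic n).biUnion fun j _ => Polynomial.finite_setOfPred_isRoot ?_
      intro h
      have h2 := Polynomial.natDegree_sub_C (p := f) (a := (j : ℤ))
      rw [h, Polynomial.natDegree_zero] at h2
      omega
    refine (h1.preimage (f := fun m : ℕ+ => ((m : ℕ) : ℤ)) (Function.Injective.injOn
      fun m m' h => PNat.coe_injective (Int.ofNat_injective h))).subset fun m hm => ?_
    refine Set.mem_biUnion (show polyNat f m ∈ Set.Iic n from hm) ?_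
    change Polynomial.eval ((m : ℕ) : ℤ) (f - Polynomial.C (polyNat f m : ℤ)) = 0
    rw [Polynomial.eval_sub, Polynomial.eval_C, sub_eq_zero]
    exact (polyNat_cast hpos m.2).symm
  refine ((finite_seq_le hA n).prod hfib).subset fun q hq => ?_
  have hq' : A q.1 + a ^ polyNat f q.2 = n := hq
  have hlt : polyNat f q.2 < a ^ polyNat f q.2 := Nat.lt_pow_self (by omega)
  exact ⟨show (A q.1 : ℝ) ≤ n by exact_mod_cast (by omega : A q.1 ≤ n),
    show polyNat f q.2 ≤ n by omega⟩

/-- Only the pairs `(k, m)` with `k ∈ K` and `m ≤ M` are counted on the left. Finiteness of the set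
of all pairs is needed: `Set.ncard` of an infinite set is `0`. -/
theorem card_filter_le_powReprCount {A : ℕ+ → ℕ} (hA : StrictMono A) {a : ℕ} (ha : 2 ≤ a)
    {f : Polynomial ℤ} (hdeg : 1 ≤ f.natDegree) (hpos : ∀ m : ℕ+, 0 < f.eval ((m : ℕ) : ℤ))
    (K : Finset ℕ+) (M n : ℕ) :
    ((K ×ˢ Finset.Icc 1 M).filter fun u : ℕ+ × ℕ => A u.1 + a ^ polyNat f u.2 = n).card ≤
      powReprCount A a f n := by
  rw [powReprCount, ← Set.ncard_coe_finset]
  refine Set.ncard_le_ncard_of_injOn (fun u => (u.1, u.2.toPNat')) ?_ ?_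
    (finite_powRepr hA ha hdeg hpos n)
  · rintro ⟨k, m⟩ hu
    rw [Finset.mem_coe, Finset.mem_filter, Finset.mem_product, Finset.mem_Icc] at hu
    change A k + a ^ (f.eval ((m.toPNat' : ℕ) : ℤ)).toNat = n
    rw [PNat.toPNat'_coe hu.1.2.1]
    exact hu.2
  · rintro ⟨k, m⟩ hu ⟨k', m'⟩ hu' h
    rw [Finset.mem_coe, Finset.mem_filter, Finset.mem_product, Finset.mem_Icc] at hu hu'
    rw [Prod.mk.injEq] at h ⊢
    refine ⟨h.1, ?_⟩
    have := congrArg (fun z : ℕ+ => (z : ℕ)) h.2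
    rwa [PNat.toPNat'_coe hu.1.2.1, PNat.toPNat'_coe hu'.1.2.1] at this

/-- A coincidence `A k₁ + a ^ F m₁ = A k₂ + a ^ F m₂` with `F m₁ = F m₂` forces `k₁ = k₂`; one with
`F m₁ < F m₂` makes `A k₂` a term whose shift by `a ^ F m₂ - a ^ F m₁` is again a term. -/
theorem energy_le {A : ℕ+ → ℕ} (hA : StrictMono A) {a : ℕ} (ha : 2 ≤ a) (F : ℕ → ℕ)
    (x : ℝ) (K : Finset ℕ+) (hK : ∀ k ∈ K, (A k : ℝ) ≤ x) (I : Finset ℕ) :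
    (((K ×ˢ I) ×ˢ (K ×ˢ I)).filter fun q : (ℕ+ × ℕ) × (ℕ+ × ℕ) =>
        A q.1.1 + a ^ F q.1.2 = A q.2.1 + a ^ F q.2.2).card ≤
      K.card * ((I ×ˢ I).filter fun q : ℕ × ℕ => F q.1 = F q.2).card +
      2 * ∑ q ∈ (I ×ˢ I).filter (fun q : ℕ × ℕ => F q.1 < F q.2),
        seqShiftCount A x (a ^ F q.2 - a ^ F q.1) := by
  classical
  set E := ((K ×ˢ I) ×ˢ (K ×ˢ I)).filter fun q : (ℕ+ × ℕ) × (ℕ+ × ℕ) =>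
        A q.1.1 + a ^ F q.1.2 = A q.2.1 + a ^ F q.2.2 with hE
  have hfin : ∀ r, {n : ℕ+ | (A n : ℝ) ≤ x ∧ A n + r ∈ Set.range A}.Finite := fun r =>
    (finite_seq_le hA x).subset fun n hn => hn.1
  have hmem : ∀ {k₁ m₁ k₂ m₂ c₁ c₂},
      ((k₁, m₁), (k₂, m₂)) ∈ E.filter (fun q => (q.1.2, q.2.2) = (c₁, c₂)) →
      k₁ ∈ K ∧ k₂ ∈ K ∧ m₁ = c₁ ∧ m₂ = c₂ ∧ A k₁ + a ^ F c₁ = A k₂ + a ^ F c₂ := by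
    intro k₁ m₁ k₂ m₂ c₁ c₂ h
    simp only [hE, Finset.mem_filter, Finset.mem_product, Prod.mk.injEq] at h
    obtain ⟨⟨⟨⟨h1, -⟩, h2, -⟩, h3⟩, rfl, rfl⟩ := h
    exact ⟨h1, h2, rfl, rfl, h3⟩
  have hfiber : ∀ c ∈ I ×ˢ I, (E.filter fun q => (q.1.2, q.2.2) = c).card ≤
      (if F c.1 = F c.2 then K.card else 0) +
      ((if F c.1 < F c.2 then seqShiftCount A x (a ^ F c.2 - a ^ F c.1) else 0) +
       (if F c.2 < F c.1 then seqShiftCount A x (a ^ F c.1 - a ^ F c.2) else 0)) := by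
    rintro ⟨c₁, c₂⟩ -
    rcases lt_trichotomy (F c₁) (F c₂) with h | h | h
    · rw [if_neg h.ne, if_pos h, if_neg h.not_gt, zero_add, add_zero, seqShiftCount,
        ← Set.ncard_coe_finset]
      have hp : a ^ F c₁ ≤ a ^ F c₂ := Nat.pow_le_pow_right (by omega) h.le
      refine Set.ncard_le_ncard_of_injOn (fun q => q.2.1) ?_ ?_ (hfin _)
      · rintro ⟨⟨k₁, m₁⟩, k₂, m₂⟩ hq
        obtain ⟨h1, h2, -, -, h3⟩ := hmem (Finset.mem_coe.1 hq)
        exact ⟨hK _ h2, k₁, by simp only; omega⟩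
      · rintro ⟨⟨k₁, m₁⟩, k₂, m₂⟩ hq ⟨⟨l₁, n₁⟩, l₂, n₂⟩ hq' heq
        obtain ⟨-, -, rfl, rfl, h3⟩ := hmem (Finset.mem_coe.1 hq)
        obtain ⟨-, -, rfl, rfl, h3'⟩ := hmem (Finset.mem_coe.1 hq')
        simp only at heq
        subst heq
        rw [hA.injective (by omega : A k₁ = A l₁)]
    · rw [if_pos h, if_neg h.not_lt, if_neg h.not_gt, add_zero, add_zero]
      refine Finset.card_le_card_of_injOn (fun q => q.2.1) ?_ ?_
      · rintro ⟨⟨k₁, m₁⟩, k₂, m₂⟩ hq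
        exact (hmem (Finset.mem_coe.1 hq)).2.1
      · rintro ⟨⟨k₁, m₁⟩, k₂, m₂⟩ hq ⟨⟨l₁, n₁⟩, l₂, n₂⟩ hq' heq
        obtain ⟨-, -, rfl, rfl, h3⟩ := hmem (Finset.mem_coe.1 hq)
        obtain ⟨-, -, rfl, rfl, h3'⟩ := hmem (Finset.mem_coe.1 hq')
        simp only at heq
        subst heq
        rw [hA.injective (by omega : A k₁ = A l₁)]
    · rw [if_neg h.ne', if_neg h.not_gt, if_pos h, zero_add, zero_add, seqShiftCount,
        ← Set.ncard_coe_finset]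
      have hp : a ^ F c₂ ≤ a ^ F c₁ := Nat.pow_le_pow_right (by omega) h.le
      refine Set.ncard_le_ncard_of_injOn (fun q => q.1.1) ?_ ?_ (hfin _)
      · rintro ⟨⟨k₁, m₁⟩, k₂, m₂⟩ hq
        obtain ⟨h1, h2, -, -, h3⟩ := hmem (Finset.mem_coe.1 hq)
        exact ⟨hK _ h1, k₂, by simp only; omega⟩
      · rintro ⟨⟨k₁, m₁⟩, k₂, m₂⟩ hq ⟨⟨l₁, n₁⟩, l₂, n₂⟩ hq' heq
        obtain ⟨-, -, rfl, rfl, h3⟩ := hmem (Finset.mem_coe.1 hq)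
        obtain ⟨-, -, rfl, rfl, h3'⟩ := hmem (Finset.mem_coe.1 hq')
        simp only at heq
        subst heq
        rw [hA.injective (by omega : A k₂ = A l₂)]
  have hswap : ∑ c ∈ I ×ˢ I,
        (if F c.2 < F c.1 then seqShiftCount A x (a ^ F c.1 - a ^ F c.2) else 0) =
      ∑ c ∈ I ×ˢ I,
        (if F c.1 < F c.2 then seqShiftCount A x (a ^ F c.2 - a ^ F c.1) else 0) :=
    Finset.sum_equiv (Equiv.prodComm ℕ ℕ) (by simp [and_comm]) fun _ _ => rfl
  calc E.card = ∑ c ∈ I ×ˢ I, (E.filter fun q => (q.1.2, q.2.2) = c).card :=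
        Finset.card_eq_sum_card_fiberwise fun q hq => by
          have := Finset.mem_filter.1 (Finset.mem_coe.1 hq)
          simp only [Finset.mem_product] at this
          exact Finset.mem_product.2 ⟨this.1.1.2, this.1.2.2⟩
    _ ≤ _ := Finset.sum_le_sum hfiber
    _ = _ := by
        rw [Finset.sum_add_distrib, Finset.sum_add_distrib, hswap, ← two_mul, ← Finset.sum_filter,
          ← Finset.sum_filter, Finset.sum_const, smul_eq_mul, mul_comm]

/-- There are `M ≍ (log x) ^ (1 / d)` such that `a ^ f(m) ≤ x / 2` for all `m ≤ M`. -/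
theorem exists_pow_polyNat_le {a : ℕ} (ha : 2 ≤ a) {f : Polynomial ℤ} (hdeg : 1 ≤ f.natDegree) :
    ∃ c x₀ : ℝ, 0 < c ∧ 4 ≤ x₀ ∧ ∀ x : ℝ, x₀ ≤ x → ∃ M : ℕ,
      (M : ℝ) ≤ Real.log x ^ (1 / (f.natDegree : ℝ)) ∧
      c * Real.log x ^ (1 / (f.natDegree : ℝ)) ≤ M ∧
      ∀ m ∈ Finset.Icc 1 M, ((a ^ polyNat f m : ℕ) : ℝ) ≤ x / 2 := by
  obtain ⟨B, hB, hBle⟩ := exists_polyNat_le f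
  set d := f.natDegree with hd
  have hB' : (1 : ℝ) ≤ B := by exact_mod_cast hB
  have ha' : (2 : ℝ) ≤ a := by exact_mod_cast ha
  -- For `m ≤ L / b` one has `f(m) log a ≤ B (L / b) ^ d a ≤ (log x) / 2`, where `L ^ d = log x`.
  set b : ℝ := 2 * B * a with hb
  have hb1 : 1 ≤ b := by nlinarith
  have hb0 : 0 < b := by linarith
  refine ⟨1 / (2 * b), max 4 (Real.exp (b ^ d)), by positivity, le_max_left _ _, fun x hx => ?_⟩
  have hx4 : 4 ≤ x := (le_max_left _ _).trans hx
  have hx0 : 0 < x := by linarith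
  have hlog : b ^ d ≤ Real.log x :=
    (Real.le_log_iff_exp_le hx0).2 ((le_max_right _ _).trans hx)
  have hlog0 : 0 ≤ Real.log x := le_trans (by positivity) hlog
  set L := Real.log x ^ (1 / (d : ℝ)) with hL
  have hL0 : 0 ≤ L := by positivity
  have hLd : L ^ d = Real.log x := by
    rw [hL, one_div, Real.rpow_inv_natCast_pow hlog0 (by omega)]
  have hbL : b ≤ L := by
    refine le_of_pow_le_pow_left₀ (by omega : d ≠ 0) hL0 ?_
    rw [hLd]; exact hlog
  have hLb : 1 ≤ L / b := by rwa [one_le_div hb0]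
  refine ⟨⌊L / b⌋₊, ?_, ?_, fun m hm => ?_⟩
  · exact (Nat.floor_le (by positivity)).trans (div_le_self hL0 hb1)
  · have h1 := Nat.lt_floor_add_one (L / b)
    have h2 : (1 : ℝ) ≤ ⌊L / b⌋₊ := by exact_mod_cast Nat.le_floor (by simpa using hLb)
    have h3 : 1 / (2 * b) * L = (L / b) / 2 := by field_simp
    rw [h3]; linarith
  · rw [Finset.mem_Icc] at hm
    have hmL : (m : ℝ) ≤ L / b :=
      le_trans (by exact_mod_cast hm.2) (Nat.floor_le (by positivity))
    have hF : (polyNat f m : ℝ) * Real.log a ≤ Real.log x / 2 := by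
      have h1 : (polyNat f m : ℝ) ≤ B * (L / b) ^ d := by
        have : (polyNat f m : ℝ) ≤ B * (m : ℝ) ^ d := by exact_mod_cast hBle m hm.1
        exact this.trans (by gcongr)
      have h2 : (L / b) ^ d ≤ Real.log x / b := by
        rw [div_pow, hLd]
        exact div_le_div_of_nonneg_left hlog0 hb0 (le_self_pow₀ hb1 (by omega))
      have h3 : Real.log a ≤ a := (Real.log_le_sub_one_of_pos (by linarith)).trans (by linarith)
      calc (polyNat f m : ℝ) * Real.log a ≤ (B * (Real.log x / b)) * a := by
            gcongr
            exact h1.trans (by gcongr)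
        _ = Real.log x / 2 := by rw [hb]; field_simp
    have h4 : Real.log 2 ≤ Real.log x / 2 := by
      have := Real.log_le_log (by norm_num) hx4
      rw [show (4 : ℝ) = 2 ^ 2 by norm_num, Real.log_pow] at this
      push_cast at this
      linarith
    push_cast
    rw [← Real.log_le_log_iff (by positivity) (by positivity), Real.log_pow,
      Real.log_div hx0.ne' (by norm_num)]
    linarith

theorem mainTheorem5 (a : ℕ) (ha : 2 ≤ a) (f : Polynomial ℤ)
    (hdeg : 1 ≤ f.natDegree) (hlead : 0 < f.leadingCoeff) (hprim : f.IsPrimitive)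
    (hpos : ∀ m : ℕ+, 0 < f.eval ((m : ℕ) : ℤ))
    (C₁ C₂ C₃ C₄ : ℝ) (hC₁ : 0 < C₁) (hC₂ : 0 < C₂) (hC₃ : 0 < C₃) (hC₄ : 0 < C₄) :
    ∃ x₀ c₁ c₂ : ℝ, 0 < x₀ ∧ 0 < c₁ ∧ 0 < c₂ ∧
      ∀ (A : ℕ+ → ℕ) (η : ℝ → ℝ) (X : ℝ), IsSieveSequence A η C₁ C₂ C₃ C₄ X →
        ∀ x : ℝ, x₀ ≤ x → X ≤ x →
          c₂ * (x * (Real.log x ^ (1 / (f.natDegree : ℝ)) /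
              (Real.log x ^ (1 / (f.natDegree : ℝ)) + η x))) ≤
            (Set.ncard {n : ℕ | 0 < n ∧ (n : ℝ) ≤ x ∧
              c₁ * (Real.log x ^ (1 / (f.natDegree : ℝ)) / η x) ≤
                (powReprCount A a f n : ℝ)} : ℝ) := by
  classical
  obtain ⟨c, x₀, hc, hx₀, hM⟩ := exists_pow_polyNat_le ha hdeg
  obtain ⟨C₅, hC₅, hpairs⟩ := exists_sum_pow_sub_pow_div_totient_le ha hdeg hlead hpos
  set d := f.natDegree with hd
  have hd0 : (0 : ℝ) < d := by exact_mod_cast hdeg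
  set c₁ : ℝ := c / (2 * C₂ * C₃) with hc₁
  set C₆ : ℝ := C₁ * d + 2 * C₄ * C₅ with hC₆
  have hc₁0 : 0 < c₁ := by positivity
  have hC₆0 : 0 < C₆ := by positivity
  refine ⟨x₀, c₁, c₁ ^ 2 / C₆, by linarith, hc₁0, by positivity, fun A η X hA x hx hXx => ?_⟩
  obtain ⟨M, hML, hLM, hMpow⟩ := hM x hx
  have hx4 : 4 ≤ x := hx₀.trans hx
  have hx0 : 0 < x := by linarith
  have hη := hA.eta_pos x hXx
  set L := Real.log x ^ (1 / (d : ℝ)) with hL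
  have hL0 : 0 < L := Real.rpow_pos_of_pos (Real.log_pos (by linarith)) _
  -- The pairs `(k, m)` in `U` have both `a_k` and `a ^ f(m)` at most `x / 2`.
  set K := (finite_seq_le hA.strictMono (x / 2)).toFinset with hK
  have hKmem : ∀ k ∈ K, (A k : ℝ) ≤ x / 2 := fun k hk => by simpa [hK] using hk
  have hKcard : K.card = seqCount A (x / 2) := by
    rw [seqCount, Set.ncard_eq_toFinset_card _ (finite_seq_le hA.strictMono (x / 2))]
  have hKlow : x / η x ≤ C₂ * C₃ * K.card := by
    rw [hKcard, mul_assoc]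
    exact (hA.le_count x hXx).trans (by gcongr; exact hA.count_le_half x hXx)
  have hKup : (K.card : ℝ) ≤ C₁ * (x / η x) := by
    refine le_trans ?_ (hA.count_le x hXx)
    rw [hKcard]
    refine Nat.cast_le.2 (Set.ncard_le_ncard (fun n hn => ?_) (finite_seq_le hA.strictMono x))
    exact le_trans (show (A n : ℝ) ≤ x / 2 from hn) (by linarith)
  set U := K ×ˢ Finset.Icc 1 M with hU
  set φ : ℕ+ × ℕ → ℕ := fun u => A u.1 + a ^ polyNat f u.2 with hφ
  set τ : ℝ := c₁ * (L / η x) with hτ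
  have hUcard : (U.card : ℝ) = K.card * M := by
    rw [hU, Finset.card_product, Nat.card_Icc, Nat.add_sub_cancel, Nat.cast_mul]
  -- The choice of `c₁` makes the threshold `τ` at most half the average size of the
  -- fibres of `φ` over the integers in `[1, x]`.
  have hUlow : x * τ ≤ (U.card : ℝ) / 2 := by
    have h1 : x / η x * (c * L) ≤ C₂ * C₃ * K.card * M := by gcongr
    have h2 : x * τ = x / η x * (c * L) / (C₂ * C₃) / 2 := by
      rw [hτ, hc₁]; field_simp
    rw [h2, hUcard]
    gcongr
    rw [div_le_iff₀ (by positivity)]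
    linarith
  have hφU : ∀ u ∈ U, φ u ∈ Finset.Icc 1 ⌊x⌋₊ := by
    rintro ⟨k, m⟩ hu
    obtain ⟨hk, hm⟩ := Finset.mem_product.1 hu
    have h1 := hKmem k hk
    have h2 := hMpow m hm
    refine Finset.mem_Icc.2 ⟨(hA.pos k).trans_le (Nat.le_add_right _ _), Nat.le_floor ?_⟩
    rw [hφ, Nat.cast_add]
    linarith
  set S := (Finset.Icc 1 ⌊x⌋₊).filter
    (fun n => τ ≤ ((U.filter fun u => φ u = n).card : ℝ)) with hS
  have hmain := sq_half_card_le_card_mul_energy U (Finset.Icc 1 ⌊x⌋₊) φ hφU τ (by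
    refine le_trans ?_ hUlow
    rw [Nat.card_Icc, Nat.add_sub_cancel]
    have := Nat.floor_le hx0.le
    gcongr) S (fun n => by rw [hS, Finset.mem_filter])
  have henergy : (((U ×ˢ U).filter fun q => φ q.1 = φ q.2).card : ℝ) ≤
      C₆ * (x * L * (L + η x) / η x ^ 2) := by
    have h1 := energy_le hA.strictMono ha (polyNat f) x K
      (fun k hk => (hKmem k hk).trans (by linarith)) (Finset.Icc 1 M)
    have h2 : (((U ×ˢ U).filter fun q => φ q.1 = φ q.2).card : ℝ) ≤
        K.card * (((Finset.Icc 1 M ×ˢ Finset.Icc 1 M).filter fun q : ℕ × ℕ =>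
          polyNat f q.1 = polyNat f q.2).card : ℝ) +
        2 * ∑ q ∈ (Finset.Icc 1 M ×ˢ Finset.Icc 1 M).filter
          (fun q : ℕ × ℕ => polyNat f q.1 < polyNat f q.2),
          (seqShiftCount A x (a ^ polyNat f q.2 - a ^ polyNat f q.1) : ℝ) := by
      exact_mod_cast h1
    have h3 : (((Finset.Icc 1 M ×ˢ Finset.Icc 1 M).filter fun q : ℕ × ℕ =>
          polyNat f q.1 = polyNat f q.2).card : ℝ) ≤ d * M := by
      exact_mod_cast card_polyNat_eq_le hdeg hlead hpos M
    have h4 : ∑ q ∈ (Finset.Icc 1 M ×ˢ Finset.Icc 1 M).filter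
          (fun q : ℕ × ℕ => polyNat f q.1 < polyNat f q.2),
          (seqShiftCount A x (a ^ polyNat f q.2 - a ^ polyNat f q.1) : ℝ) ≤
        C₄ * (x / η x ^ 2) * (C₅ * (M : ℝ) ^ 2) := by
      refine le_trans (Finset.sum_le_sum fun q hq => ?_)
        ((Finset.mul_sum _ _ _).symm.trans_le
          (mul_le_mul_of_nonneg_left (hpairs M) (by positivity)))
      have hlt : a ^ polyNat f q.1 < a ^ polyNat f q.2 :=
        Nat.pow_lt_pow_right (by omega) (Finset.mem_filter.1 hq).2
      exact (hA.shiftCount_le x hXx _ (Nat.sub_pos_of_lt hlt)).trans_eq (by ring)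
    calc _ ≤ _ := h2
      _ ≤ C₁ * (x / η x) * (d * L) + 2 * (C₄ * (x / η x ^ 2) * (C₅ * L ^ 2)) := by
        gcongr
        · exact h3.trans (by gcongr)
        · exact h4.trans (by gcongr)
      _ = C₁ * d * (x * L * η x / η x ^ 2) + 2 * C₄ * C₅ * (x * L * L / η x ^ 2) := by
        field_simp
      _ ≤ C₁ * d * (x * L * (L + η x) / η x ^ 2) +
          2 * C₄ * C₅ * (x * L * (L + η x) / η x ^ 2) := by
        gcongr <;> linarith
      _ = _ := by rw [hC₆]; ring
  have hScard : c₁ ^ 2 / C₆ * (x * (L / (L + η x))) ≤ S.card := by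
    have h1 : (x * τ) ^ 2 ≤ S.card * (C₆ * (x * L * (L + η x) / η x ^ 2)) :=
      calc (x * τ) ^ 2 ≤ ((U.card : ℝ) / 2) ^ 2 := by gcongr
        _ ≤ _ := hmain
        _ ≤ _ := by gcongr
    have h2 : 0 < C₆ * (x * L * (L + η x) / η x ^ 2) := by positivity
    rw [← div_le_iff₀ h2] at h1
    refine le_trans (le_of_eq ?_) h1
    rw [hτ]
    field_simp
  refine hScard.trans (Nat.cast_le.2 ?_)
  rw [← Set.ncard_coe_finset]
  refine Set.ncard_le_ncard (fun n hn => ?_) ((Set.finite_Iic ⌊x⌋₊).subset fun n hn =>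
    Nat.le_floor hn.2.1)
  obtain ⟨h1, h2⟩ := Finset.mem_filter.1 (Finset.mem_coe.1 hn)
  obtain ⟨h3, h4⟩ := Finset.mem_Icc.1 h1
  exact ⟨h3, (Nat.le_floor_iff hx0.le).1 h4, h2.trans (Nat.cast_le.2
    (card_filter_le_powReprCount hA.strictMono ha hdeg hpos K M n))⟩
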